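/- For $p,q>0$, $x\ge 0$ and $0\le y\le 1$ let $$B_{p,q}(x,y)=e^{-x/2}\sum_{j=0}^{\infty}\frac{1}{j!}\Bigl(\frac x2\Bigr)^j I_y(p+j,q),\qquad I_y(p,q)=\frac{\Gamma(p+q)}{\Gamma(p)\Gamma(q)}\int_0^y t^{p-1}(1-t)^{q-1}\,dt,$$ be the cumulative noncentral beta distribution function. Put $z=\tfrac12xy$, let $(a)_n=a(a+1)\cdots(a+n-1)$, $(a)_0=1$, and for $n\ge 0$ and $0<y<1$ set $$a_n=(-1)^n\frac{(1-p-q)_n}{n!},\qquad b_n=\Bigl(\frac{y}{1-y}\Bigr)^n,\qquad c_n=\sum_{m=0}^n a_m b_{n-m}.$$ Then $$B_{p,q}(x,y)\sim \frac{e^{-(1-y)x/2}\,y^p(1-y)^{q-1}z^{q-1}}{\Gamma(q)}\sum_{n=0}^\infty(-1)^n(1-q)_n\frac{c_n}{z^n},\qquad z\to\infty,$$ uniformly for $0<y\le 1-\delta$ with fixed $\delta>0$ and for $p,q>0$ bounded with $p+q$ bounded away from $0$. That is, for all $R,\varepsilon,\delta>0$ and every integer $N\ge 0$ there are constants $C,Z>0$,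 depending only on $R,\varepsilon,\delta,N$, such that $$\Bigl|B_{p,q}(x,y)-P\sum_{n=0}^{N-1}(-1)^n(1-q)_n\frac{c_n}{z^n}\Bigr|\le \frac{C\,P}{z^{N}},\qquad P=\frac{e^{-(1-y)x/2}y^p(1-y)^{q-1}z^{q-1}}{\Gamma(q)},$$ whenever $0<p\le R$, $0<q\le R$, $p+q\ge\varepsilon$, $0<y\le 1-\delta$ and $z\ge Z$. Moreover, the expansion is finite and exact when $q$ is a positive integer: for all $p>0$, $x>0$, $0<y<1$ and every integer $q\ge 1$, the terms with $n\ge q$ vanish and $$B_{p,q}(x,y)=\frac{e^{-(1-y)x/2}\,y^p(1-y)^{q-1}z^{q-1}}{\Gamma(q)}\sum_{n=0}^{q-1}(-1)^n(1-q)_n\frac{c_n}{z^n}.$$ -/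

import Mathlib

noncomputable section

/-- The central beta distribution function `I_y(p,q)` (regularized incomplete beta function);
`ProbabilityTheory.beta p q = Γ(p) Γ(q) / Γ(p+q)`. -/
def centralBetaCDF (p q y : ℝ) : ℝ :=
  1 / ProbabilityTheory.beta p q * ∫ t in (0 : ℝ)..y, t ^ (p - 1) * (1 - t) ^ (q - 1)

/-- The cumulative noncentral beta distribution function `B_{p,q}(x,y)`. -/
def noncentralBetaCDF (p q x y : ℝ) : ℝ :=
  Real.exp (-x / 2) *
    ∑' j : ℕ, 1 / (j.factorial : ℝ) * (x / 2) ^ j * centralBetaCDF (p + j) q y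

/-- The Pochhammer symbol `(a)_n = a (a+1) ⋯ (a+n-1)`. -/
def pochhammerSymbol (a : ℝ) (n : ℕ) : ℝ := (ascPochhammer ℝ n).eval a

/-- `a_n = (-1)^n (1-p-q)_n / n!`, the Taylor coefficients of `t^(p+q-1)` at `t = 1`. -/
def coeffA (p q : ℝ) (n : ℕ) : ℝ :=
  (-1) ^ n * pochhammerSymbol (1 - p - q) n / (n.factorial : ℝ)

/-- `b_n = (y/(1-y))^n`, the Taylor coefficients of `(1-y)/(1-yt)` at `t = 1`. -/
def coeffB (y : ℝ) (n : ℕ) : ℝ := (y / (1 - y)) ^ n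

/-- `c_n = ∑_{m=0}^n a_m b_{n-m}`. -/
def coeffC (p q y : ℝ) (n : ℕ) : ℝ :=
  ∑ m ∈ Finset.range (n + 1), coeffA p q m * coeffB y (n - m)

/-- The factor `e^{-(1-y)x/2} y^p (1-y)^{q-1} z^{q-1} / Γ(q)` with `z = xy/2`. -/
def largeZPrefactor (p q x y : ℝ) : ℝ :=
  Real.exp (-(1 - y) * x / 2) * y ^ p * (1 - y) ^ (q - 1) * (x * y / 2) ^ (q - 1) /
    Real.Gamma q

/-- The `n`-th term `(-1)^n (1-q)_n c_n / z^n` with `z = xy/2`. -/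
def largeZTerm (p q x y : ℝ) (n : ℕ) : ℝ :=
  (-1) ^ n * pochhammerSymbol (1 - q) n * (coeffC p q y n / (x * y / 2) ^ n)

end

open MeasureTheory Filter Topology

/-! ### Pochhammer symbols and the Taylor coefficients of a power -/

/-! Integration by parts gives `I_y(p,q) - I_y(p+1,q)` in closed form. Averaged over the Poisson
weights, this makes `B_{p,q} - B_{p+1,q}` an elementary factor times `F(q,a,z) = scaledKummer q a z`
with `a = p+q`. Since `B_{p+n,q} → 0`, telescoping writes `B_{p,q}` as that factor times `∑ y^m F(q,
p+q+m, z)` (`hasSum_noncentralBetaCDF`).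

For `q < 1`, `F(q,a,z) = Γ(1-q)⁻¹ ∫_0^1 e^{-zs} s^{-q} (1-s)^{a-1} ds`, so Watson's lemma expands
`F` in the terms `z^{q-1-n} (1-q)_n (1-a)_n / n!`. Larger `q` are reached by `F(q+1,a+1) = z
F(q,a+1) + a F(q,a)`, which the expansion, hence its remainder, also satisfies
(`kummerRemainder_add_one`). From `F(1,a,z) = 1` the same recurrence gives exactness for integer
`q`.

Summing `y^m (1-a-m)_n / n!` over `m` produces `(-1)^n c_n / (1-y)`. For uniformity, `a` times the
remainder is bounded by a polynomial in `a` times `z^{q-1-N}` (`exists_kummerRemainder_bound`). The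
polynomial is summable against `y^m` when `y ≤ 1-δ`, and the factor `a` costs only `1/ε`. -/

theorem pochhammerSymbol_zero (x : ℝ) : pochhammerSymbol x 0 = 1 := by
  simp [pochhammerSymbol]

theorem pochhammerSymbol_succ (x : ℝ) (n : ℕ) :
    pochhammerSymbol x (n + 1) = pochhammerSymbol x n * (x + n) :=
  ascPochhammer_succ_eval n x

theorem pochhammerSymbol_succ_left (x : ℝ) (n : ℕ) :
    pochhammerSymbol x (n + 1) = x * pochhammerSymbol (x + 1) n := by
  induction n with
  | zero => simp [pochhammerSymbol_succ, pochhammerSymbol_zero]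
  | succ n ih =>
    rw [pochhammerSymbol_succ, ih, pochhammerSymbol_succ (x + 1)]
    push_cast
    ring

theorem pochhammerSymbol_one_sub_natCast_eq_zero {k n : ℕ} (hk : 1 ≤ k) (hn : k ≤ n) :
    pochhammerSymbol (1 - (k : ℝ)) n = 0 := by
  induction n, hn using Nat.le_induction with
  | base =>
    obtain ⟨m, rfl⟩ : ∃ m, k = m + 1 := ⟨k - 1, by omega⟩
    rw [pochhammerSymbol_succ]
    push_cast
    ring
  | succ n _ ih => rw [pochhammerSymbol_succ, ih, zero_mul]

/-- The coefficient `(1 - a)_n / n!` of `s ^ n` in the Taylor series of `(1 - s) ^ (a - 1)`. -/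
noncomputable def powerTaylorCoeff (n : ℕ) (a : ℝ) : ℝ :=
  pochhammerSymbol (1 - a) n / (n.factorial : ℝ)

theorem powerTaylorCoeff_zero (a : ℝ) : powerTaylorCoeff 0 a = 1 := by
  simp [powerTaylorCoeff, pochhammerSymbol_zero]

theorem powerTaylorCoeff_succ (n : ℕ) (a : ℝ) :
    powerTaylorCoeff (n + 1) a = powerTaylorCoeff n a * ((n + 1 - a) / (n + 1)) := by
  have : (n.factorial : ℝ) ≠ 0 := by positivity
  rw [powerTaylorCoeff, powerTaylorCoeff, pochhammerSymbol_succ, Nat.factorial_succ]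
  push_cast
  field_simp
  ring

/-- Coefficientwise form of differentiating `(1-s)^(a-1)`. -/
theorem succ_mul_powerTaylorCoeff_succ (n : ℕ) (a : ℝ) :
    (n + 1) * powerTaylorCoeff (n + 1) a = (1 - a) * powerTaylorCoeff n (a - 1) := by
  have : (n.factorial : ℝ) ≠ 0 := by positivity
  rw [powerTaylorCoeff, powerTaylorCoeff, pochhammerSymbol_succ_left, Nat.factorial_succ,
    show 1 - a + 1 = 1 - (a - 1) by ring]
  push_cast
  field_simp

/-- Compare coefficients in `(1-s)^a = (1-s) (1-s)^(a-1)`. -/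
theorem powerTaylorCoeff_succ_add_one (n : ℕ) (a : ℝ) :
    powerTaylorCoeff (n + 1) (a + 1) = powerTaylorCoeff (n + 1) a - powerTaylorCoeff n a := by
  have h1 := succ_mul_powerTaylorCoeff_succ n (a + 1)
  rw [add_sub_cancel_right] at h1
  have h2 := powerTaylorCoeff_succ n a
  have hn : (n + 1 : ℝ) ≠ 0 := by positivity
  field_simp at h2
  have : (n + 1 : ℝ) * powerTaylorCoeff (n + 1) (a + 1) =
      (n + 1) * (powerTaylorCoeff (n + 1) a - powerTaylorCoeff n a) := by linarith
  exact mul_left_cancel₀ hn this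

theorem abs_powerTaylorCoeff_le (n : ℕ) {a : ℝ} (ha : 0 ≤ a) :
    |powerTaylorCoeff n a| ≤ (1 + a) ^ n := by
  induction n with
  | zero => simp [powerTaylorCoeff_zero]
  | succ n ih =>
    rw [powerTaylorCoeff_succ, abs_mul, pow_succ]
    have hn : (0 : ℝ) < n + 1 := by positivity
    gcongr
    rw [abs_div, abs_of_pos hn, div_le_iff₀ hn, abs_le]
    have : 0 ≤ (n : ℝ) * a := by positivity
    constructor <;> nlinarith

/-- The expansion coefficients obey the recurrence of `scaledKummer_add_one`, which is what lets it
pass to the remainders. -/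
theorem pochhammerSymbol_neg_mul_powerTaylorCoeff (n : ℕ) (q a : ℝ) :
    pochhammerSymbol (1 - (q + 1)) (n + 1) * powerTaylorCoeff (n + 1) (a + 1) =
      pochhammerSymbol (1 - q) (n + 1) * powerTaylorCoeff (n + 1) (a + 1) +
        a * (pochhammerSymbol (1 - q) n * powerTaylorCoeff n a) := by
  have h1 := succ_mul_powerTaylorCoeff_succ n (a + 1)
  rw [add_sub_cancel_right] at h1
  rw [pochhammerSymbol_succ_left, pochhammerSymbol_succ (1 - q),
    show 1 - (q + 1) + 1 = 1 - q by ring]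
  linear_combination (-pochhammerSymbol (1 - q) n) * h1

theorem coeffA_eq_powerTaylorCoeff (p q : ℝ) (n : ℕ) :
    coeffA p q n = (-1) ^ n * powerTaylorCoeff n (p + q) := by
  rw [coeffA, powerTaylorCoeff, mul_div_assoc, sub_sub]

theorem coeffC_succ (p q y : ℝ) (n : ℕ) :
    coeffC p q y (n + 1) = coeffA p q (n + 1) + y / (1 - y) * coeffC p q y n := by
  rw [coeffC, Finset.sum_range_succ, coeffC, Finset.mul_sum, add_comm]
  congr 1
  · simp [coeffB]
  · refine Finset.sum_congr rfl fun m hm => ?_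
    rw [Finset.mem_range] at hm
    rw [coeffB, coeffB, show n + 1 - m = (n - m) + 1 by omega, pow_succ]
    ring

theorem summable_pow_mul_add_pow (M : ℕ) {y : ℝ} (hy0 : 0 ≤ y) (hy1 : y < 1) (A : ℝ) :
    Summable fun m : ℕ => y ^ m * (A + m) ^ M := by
  simp_rw [add_pow, Finset.mul_sum]
  refine summable_sum fun i _ => ?_
  have h := (summable_pow_mul_geometric_of_norm_lt_one (R := ℝ) (M - i)
    (r := y) (by rwa [Real.norm_of_nonneg hy0])).mul_left (A ^ i * (M.choose i : ℝ))
  exact h.congr fun m => by ring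

theorem summable_pow_mul_powerTaylorCoeff (n : ℕ) {a y : ℝ} (ha : 0 ≤ a) (hy0 : 0 ≤ y)
    (hy1 : y < 1) : Summable fun m : ℕ => y ^ m * powerTaylorCoeff n (a + m) := by
  refine (summable_pow_mul_add_pow n hy0 hy1 (1 + a)).of_norm_bounded fun m => ?_
  rw [norm_mul, norm_pow, Real.norm_of_nonneg hy0, Real.norm_eq_abs, add_assoc 1 a]
  gcongr
  exact abs_powerTaylorCoeff_le n (by positivity)

/-- In generating form, `∑ y^m (1-s)^(p+q+m-1)` is `t^(p+q-1) / (1-yt)` at `t = 1-s`. The proof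
instead shifts `m` by one, which gives a recurrence in `n` for the sums that matches `coeffC_succ`.
-/
theorem hasSum_pow_mul_powerTaylorCoeff (n : ℕ) {p q y : ℝ} (ha : 0 ≤ p + q) (hy0 : 0 ≤ y)
    (hy1 : y < 1) :
    HasSum (fun m : ℕ => y ^ m * powerTaylorCoeff n (p + q + m))
      ((-1) ^ n * coeffC p q y n / (1 - y)) := by
  have hy : 1 - y ≠ 0 := by linarith
  induction n with
  | zero =>
    simpa [powerTaylorCoeff_zero, coeffC, coeffA, coeffB, pochhammerSymbol_zero] using
      hasSum_geometric_of_lt_one hy0 hy1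
  | succ n ih =>
    have hs := (summable_pow_mul_powerTaylorCoeff (n + 1) ha hy0 hy1).hasSum
    set S := ∑' m : ℕ, y ^ m * powerTaylorCoeff (n + 1) (p + q + m) with hS
    have h1 := (hasSum_nat_add_iff' 1).mpr hs
    have h2 := (hs.sub ih).mul_left y
    have h3 := h1.unique (h2.congr_fun fun m => by
      have := powerTaylorCoeff_succ_add_one n (p + q + m)
      push_cast
      rw [← add_assoc, this]
      ring)
    simp only [Finset.range_one, Finset.sum_singleton, pow_zero, Nat.cast_zero, add_zero,
      one_mul] at h3
    have hv : (-1) ^ (n + 1) * coeffC p q y (n + 1) / (1 - y) = S := by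
      rw [coeffC_succ, coeffA_eq_powerTaylorCoeff]
      have h4 : ((-1 : ℝ) ^ (n + 1)) * (-1) ^ (n + 1) = 1 := by
        rw [← mul_pow]; simp
      have h5 : (1 - y) * S = powerTaylorCoeff (n + 1) (p + q) -
          y * ((-1) ^ n * coeffC p q y n / (1 - y)) := by linarith
      rw [mul_add, ← mul_assoc, h4, div_eq_iff hy, mul_comm S, h5]
      ring
    rwa [hv]

/-! ### A Kummer-type series and its recurrence -/

/-- The terms of the series `∑ z^j / j! Γ(a+j) / Γ(a+j+1-q)`, a multiple of
Kummer's function `M(a, a+1-q, z)`. -/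
noncomputable def kummerTerm (q a z : ℝ) (j : ℕ) : ℝ :=
  z ^ j / (j.factorial : ℝ) * (Real.Gamma (a + j) / Real.Gamma (a + j + 1 - q))

/-- The Kummer-type series multiplied by `e^{-z}`. -/
noncomputable def scaledKummer (q a z : ℝ) : ℝ :=
  Real.exp (-z) * ∑' j, kummerTerm q a z j

/-- The error of the `N`-term large-`z` expansion of `scaledKummer`. -/
noncomputable def kummerRemainder (N : ℕ) (q a z : ℝ) : ℝ :=
  scaledKummer q a z -
    ∑ n ∈ Finset.range N, z ^ (q - 1 - n) * (pochhammerSymbol (1 - q) n * powerTaylorCoeff n a)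

theorem kummerTerm_nonneg {q a z : ℝ} (ha : 0 ≤ a) (hqa : q ≤ a + 1) (hz : 0 ≤ z) (j : ℕ) :
    0 ≤ kummerTerm q a z j := by
  have hj : (0 : ℝ) ≤ j := j.cast_nonneg
  exact mul_nonneg (by positivity) (div_nonneg (Real.Gamma_nonneg_of_nonneg (by linarith))
    (Real.Gamma_nonneg_of_nonneg (by linarith)))

/-- Write `Γ(a+j+1) = (a+j) Γ(a+j)`. The part with `a` is the old series; the part with `j` cancels
against `j!` and, after an index shift, is `z` times the series at `a+1`. -/
theorem hasSum_kummerTerm_add_one {q a z s t : ℝ} (ha : 0 < a)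
    (hs : HasSum (kummerTerm q a z) s) (ht : HasSum (kummerTerm q (a + 1) z) t) :
    HasSum (kummerTerm (q + 1) (a + 1) z) (a * s + z * t) := by
  have hshift : HasSum (fun j : ℕ => j * kummerTerm q a z j) (z * t) := by
    rw [← hasSum_nat_add_iff' 1]
    simp only [Finset.range_one, Finset.sum_singleton, Nat.cast_zero, zero_mul, sub_zero]
    refine (ht.mul_left z).congr_fun fun j => ?_
    have : (j.factorial : ℝ) ≠ 0 := by positivity
    rw [kummerTerm, kummerTerm, Nat.factorial_succ]
    push_cast
    rw [show a + (j + 1 : ℝ) = a + 1 + j by ring, pow_succ']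
    field_simp
  refine ((hs.mul_left a).add hshift).congr_fun fun j => ?_
  have hj : a + (j : ℝ) ≠ 0 := by positivity
  rw [kummerTerm, kummerTerm, show a + 1 + (j : ℝ) = a + j + 1 by ring, Real.Gamma_add_one hj,
    show a + (j : ℝ) + 1 + 1 - (q + 1) = a + j + 1 - q by ring]
  ring

theorem scaledKummer_add_one {q a z : ℝ} (ha : 0 < a)
    (hs : Summable (kummerTerm q a z)) (ht : Summable (kummerTerm q (a + 1) z)) :
    scaledKummer (q + 1) (a + 1) z = z * scaledKummer q (a + 1) z + a * scaledKummer q a z := by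
  rw [scaledKummer, (hasSum_kummerTerm_add_one ha hs.hasSum ht.hasSum).tsum_eq, scaledKummer,
    scaledKummer]
  ring

theorem kummerRemainder_zero (q a z : ℝ) : kummerRemainder 0 q a z = scaledKummer q a z := by
  simp [kummerRemainder]

theorem kummerRemainder_add_one (N : ℕ) {q a z : ℝ} (ha : 0 < a) (hz : 0 < z)
    (hs : Summable (kummerTerm q a z)) (ht : Summable (kummerTerm q (a + 1) z)) :
    kummerRemainder (N + 1) (q + 1) (a + 1) z =
      z * kummerRemainder (N + 1) q (a + 1) z + a * kummerRemainder N q a z := by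
  have key : ∑ n ∈ Finset.range (N + 1), z ^ (q + 1 - 1 - n) *
        (pochhammerSymbol (1 - (q + 1)) n * powerTaylorCoeff n (a + 1)) =
      z * ∑ n ∈ Finset.range (N + 1), z ^ (q - 1 - n) *
        (pochhammerSymbol (1 - q) n * powerTaylorCoeff n (a + 1)) +
      a * ∑ n ∈ Finset.range N, z ^ (q - 1 - n) *
        (pochhammerSymbol (1 - q) n * powerTaylorCoeff n a) := by
    have hpow (r : ℝ) : z ^ (r + 1) = z ^ r * z := Real.rpow_add_one hz.ne' r
    rw [Finset.sum_range_succ', Finset.sum_range_succ', mul_add, Finset.mul_sum, Finset.mul_sum,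
      add_right_comm, ← Finset.sum_add_distrib]
    congr 1
    · refine Finset.sum_congr rfl fun n _ => ?_
      rw [pochhammerSymbol_neg_mul_powerTaylorCoeff]
      push_cast
      rw [show q + 1 - 1 - (n + 1 : ℝ) = q - 1 - n by ring,
        show q - 1 - (n : ℝ) = q - 1 - (n + 1) + 1 by ring, hpow]
      ring
    · simp only [pochhammerSymbol_zero, powerTaylorCoeff_zero, Nat.cast_zero, sub_zero]
      rw [show q + 1 - 1 = q - 1 + 1 by ring, hpow]
      ring
  rw [kummerRemainder, key, scaledKummer_add_one ha hs ht, kummerRemainder, kummerRemainder]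
  ring

theorem hasSum_kummerTerm_one {a : ℝ} (ha : 0 < a) (z : ℝ) :
    HasSum (kummerTerm 1 a z) (Real.exp z) := by
  rw [Real.exp_eq_exp_ℝ]
  refine (NormedSpace.expSeries_div_hasSum_exp (𝔸 := ℝ) z).congr_fun fun j => ?_
  have : Real.Gamma (a + j) ≠ 0 := (Real.Gamma_pos_of_pos (by positivity)).ne'
  rw [kummerTerm, add_sub_cancel_right, div_self this, mul_one]

theorem scaledKummer_one {a : ℝ} (ha : 0 < a) (z : ℝ) : scaledKummer 1 a z = 1 := by
  rw [scaledKummer, (hasSum_kummerTerm_one ha z).tsum_eq, ← Real.exp_add, neg_add_cancel,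
    Real.exp_zero]

theorem kummerRemainder_one (N : ℕ) {a : ℝ} (ha : 0 < a) (z : ℝ) :
    kummerRemainder (N + 1) 1 a z = 0 := by
  rw [kummerRemainder, scaledKummer_one ha, Finset.sum_range_succ', Finset.sum_eq_zero]
  · simp [pochhammerSymbol_zero, powerTaylorCoeff_zero]
  · intro n _
    have := pochhammerSymbol_one_sub_natCast_eq_zero (k := 1) (n := n + 1) le_rfl (by omega)
    rw [Nat.cast_one] at this
    rw [this]
    ring

/-! ### Telescoping the noncentral beta distribution function -/

theorem intervalIntegrable_betaDensity {a b y : ℝ} (ha : 0 < a) (hy0 : 0 ≤ y) (hy1 : y < 1) :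
    IntervalIntegrable (fun t : ℝ => t ^ (a - 1) * (1 - t) ^ (b - 1)) volume 0 y := by
  refine (intervalIntegral.intervalIntegrable_rpow' (by linarith)).mul_continuousOn ?_
  refine ContinuousOn.rpow_const (by fun_prop) fun t ht => Or.inl ?_
  rw [Set.uIcc_of_le hy0] at ht
  linarith [ht.2]

/-- Integrate the derivative of `t^a (1-t)^b`, which is `(a t^(a-1) - (a+b) t^a) (1-t)^(b-1)`. -/
theorem rpow_mul_one_sub_rpow_eq_integral {a b y : ℝ} (ha : 0 < a) (hb : 0 < b) (hy0 : 0 ≤ y)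
    (hy1 : y < 1) :
    y ^ a * (1 - y) ^ b = a * (∫ t in (0 : ℝ)..y, t ^ (a - 1) * (1 - t) ^ (b - 1)) -
      (a + b) * ∫ t in (0 : ℝ)..y, t ^ (a + 1 - 1) * (1 - t) ^ (b - 1) := by
  have h1 := intervalIntegrable_betaDensity (b := b) ha hy0 hy1
  have h2 := intervalIntegrable_betaDensity (a := a + 1) (b := b) (by linarith) hy0 hy1
  rw [← intervalIntegral.integral_const_mul, ← intervalIntegral.integral_const_mul,
    ← intervalIntegral.integral_sub (h1.const_mul a) (h2.const_mul (a + b)),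
    intervalIntegral.integral_eq_sub_of_hasDerivAt_of_le
      (f := fun t : ℝ => t ^ a * (1 - t) ^ b) hy0 ?_ ?_
      ((h1.const_mul a).sub (h2.const_mul (a + b)))]
  · simp [Real.zero_rpow ha.ne']
  · exact (ContinuousOn.rpow_const (by fun_prop) fun _ _ => Or.inr ha.le).mul
      (ContinuousOn.rpow_const (by fun_prop) fun _ _ => Or.inr hb.le)
  · intro t ht
    have ht0 : 0 < t := ht.1
    have ht1 : 0 < 1 - t := by linarith [ht.2]
    have d1 := Real.hasDerivAt_rpow_const (x := t) (p := a) (Or.inl ht0.ne')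
    have d2 := ((hasDerivAt_id t).const_sub 1).rpow_const (p := b) (Or.inl ht1.ne')
    refine (d1.mul d2).congr_deriv ?_
    have e1 : t ^ a = t ^ (a - 1) * t := by rw [← Real.rpow_add_one ht0.ne', sub_add_cancel]
    have e2 : (1 - t) ^ b = (1 - t) ^ (b - 1) * (1 - t) := by
      rw [← Real.rpow_add_one ht1.ne', sub_add_cancel]
    simp only [id, add_sub_cancel_right]
    rw [e1, e2]
    ring

theorem centralBetaCDF_eq_add {a b y : ℝ} (ha : 0 < a) (hb : 0 < b) (hy0 : 0 ≤ y) (hy1 : y < 1) :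
    centralBetaCDF a b y = centralBetaCDF (a + 1) b y +
      y ^ a * (1 - y) ^ b / Real.Gamma b * (Real.Gamma (a + b) / Real.Gamma (a + 1)) := by
  have ga := (Real.Gamma_pos_of_pos ha).ne'
  have gb := (Real.Gamma_pos_of_pos hb).ne'
  have gab := (Real.Gamma_pos_of_pos (add_pos ha hb)).ne'
  have hab : a + b ≠ 0 := by positivity
  rw [rpow_mul_one_sub_rpow_eq_integral ha hb hy0 hy1, centralBetaCDF, centralBetaCDF,
    ProbabilityTheory.beta, ProbabilityTheory.beta, show a + 1 + b = a + b + 1 by ring,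
    Real.Gamma_add_one ha.ne', Real.Gamma_add_one hab]
  field_simp
  ring

theorem centralBetaCDF_nonneg {a b y : ℝ} (ha : 0 < a) (hb : 0 < b) (hy0 : 0 ≤ y) (hy1 : y < 1) :
    0 ≤ centralBetaCDF a b y := by
  refine mul_nonneg (one_div_nonneg.mpr (ProbabilityTheory.beta_pos ha hb).le)
    (intervalIntegral.integral_nonneg hy0 fun t ht => ?_)
  exact mul_nonneg (Real.rpow_nonneg ht.1 _) (Real.rpow_nonneg (by linarith [ht.2]) _)

theorem centralBetaCDF_increment_nonneg {a b y : ℝ} (ha : 0 < a) (hb : 0 < b) (hy0 : 0 ≤ y)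
    (hy1 : y < 1) :
    0 ≤ y ^ a * (1 - y) ^ b / Real.Gamma b * (Real.Gamma (a + b) / Real.Gamma (a + 1)) := by
  have := Real.Gamma_pos_of_pos hb
  have := Real.Gamma_pos_of_pos (add_pos ha hb)
  have := Real.Gamma_pos_of_pos (s := a + 1) (by linarith)
  have := Real.rpow_nonneg (x := 1 - y) (by linarith) b
  positivity

theorem centralBetaCDF_antitone {a b y : ℝ} (ha : 0 < a) (hb : 0 < b) (hy0 : 0 ≤ y)
    (hy1 : y < 1) : Antitone fun n : ℕ => centralBetaCDF (a + n) b y := by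
  refine antitone_nat_of_succ_le fun n => ?_
  have han : 0 < a + n := by positivity
  have h1 := centralBetaCDF_eq_add han hb hy0 hy1
  have h2 := centralBetaCDF_increment_nonneg han hb hy0 hy1
  push_cast
  rw [← add_assoc]
  linarith

theorem centralBetaCDF_add_natCast_le {a b y : ℝ} (ha : 0 < a) (hb : 0 < b) (hy0 : 0 ≤ y)
    (hy1 : y < 1) (n : ℕ) : centralBetaCDF (a + n) b y ≤ centralBetaCDF a b y := by
  simpa using centralBetaCDF_antitone ha hb hy0 hy1 (Nat.zero_le n)

/-- Fix `w` with `y < w < 1`. The increment at `w` is at most `I_w(a,b)`, which bounds the Gamma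
quotient by a multiple of `(a+n) / w^n` without Stirling's formula. The integral up to `y` shrinks
like `y^n`, so `(y/w)^n` wins. -/
theorem tendsto_centralBetaCDF_add_natCast {a b y : ℝ} (ha : 0 < a) (hb : 0 < b) (hy0 : 0 < y)
    (hy1 : y < 1) : Tendsto (fun n : ℕ => centralBetaCDF (a + n) b y) atTop (𝓝 0) := by
  obtain ⟨w, hyw, hw1⟩ := exists_between hy1
  have hw0 : 0 < w := hy0.trans hyw
  set J := ∫ t in (0 : ℝ)..y, t ^ (a - 1) * (1 - t) ^ (b - 1) with hJ
  have hJ0 : 0 ≤ J := intervalIntegral.integral_nonneg hy0.le fun t ht =>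
    mul_nonneg (Real.rpow_nonneg ht.1 _) (Real.rpow_nonneg (by linarith [ht.2]) _)
  have hgb := Real.Gamma_pos_of_pos hb
  have hwb : 0 < (1 - w) ^ b := Real.rpow_pos_of_pos (by linarith) b
  have hwa : 0 < w ^ a := Real.rpow_pos_of_pos hw0 a
  set K := centralBetaCDF a b w / (w ^ a * (1 - w) ^ b) * J with hK
  have hbound (n : ℕ) : centralBetaCDF (a + n) b y ≤ K * ((y / w) ^ n * (a + n) ^ 1) := by
    have han : 0 < a + n := by positivity
    have hga := Real.Gamma_pos_of_pos han
    have hgab := Real.Gamma_pos_of_pos (add_pos han hb)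
    have h1 : w ^ (a + n) * (1 - w) ^ b / Real.Gamma b *
        (Real.Gamma (a + n + b) / Real.Gamma (a + n + 1)) ≤ centralBetaCDF a b w := by
      have e1 := centralBetaCDF_eq_add han hb hw0.le hw1
      have e2 := centralBetaCDF_add_natCast_le ha hb hw0.le hw1 n
      have e3 := centralBetaCDF_nonneg (a := a + n + 1) (by linarith) hb hw0.le hw1
      linarith
    have h2 : (∫ t in (0 : ℝ)..y, t ^ (a + n - 1) * (1 - t) ^ (b - 1)) ≤ y ^ n * J := by
      rw [hJ, ← intervalIntegral.integral_const_mul]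
      refine intervalIntegral.integral_mono_on_of_le_Ioo hy0.le
        (intervalIntegrable_betaDensity han hy0.le hy1)
        ((intervalIntegrable_betaDensity ha hy0.le hy1).const_mul _) fun t ht => ?_
      have ht0 : 0 < t := ht.1
      have : t ^ n ≤ y ^ n := pow_le_pow_left₀ ht0.le ht.2.le n
      rw [show a + n - 1 = a - 1 + n by ring, Real.rpow_add ht0, Real.rpow_natCast, ← mul_assoc,
        mul_comm (y ^ n)]
      have h3 := Real.rpow_nonneg (x := 1 - t) (by linarith [ht.2]) (b - 1)
      gcongr
    rw [Real.Gamma_add_one han.ne', Real.rpow_add hw0, Real.rpow_natCast] at h1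
    have h3 : Real.Gamma (a + n + b) / (Real.Gamma (a + n) * Real.Gamma b) ≤
        centralBetaCDF a b w / (w ^ a * (1 - w) ^ b) * ((a + n) / w ^ n) := by
      rw [div_mul_div_comm, div_le_div_iff₀ (by positivity) (by positivity)]
      rw [div_mul_div_comm, div_le_iff₀ (by positivity)] at h1
      linarith
    calc centralBetaCDF (a + n) b y
        = Real.Gamma (a + n + b) / (Real.Gamma (a + n) * Real.Gamma b) *
          ∫ t in (0 : ℝ)..y, t ^ (a + n - 1) * (1 - t) ^ (b - 1) := by
          rw [centralBetaCDF, ProbabilityTheory.beta, one_div_div]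
      _ ≤ (centralBetaCDF a b w / (w ^ a * (1 - w) ^ b) * ((a + n) / w ^ n)) * (y ^ n * J) := by
          have hI := centralBetaCDF_nonneg ha hb hw0.le hw1
          refine mul_le_mul h3 h2 (intervalIntegral.integral_nonneg hy0.le fun t ht => ?_)
            (by positivity)
          exact mul_nonneg (Real.rpow_nonneg ht.1 _) (Real.rpow_nonneg (by linarith [ht.2]) _)
      _ = K * ((y / w) ^ n * (a + n) ^ 1) := by
          rw [hK, div_pow]
          ring
  have hlim := ((summable_pow_mul_add_pow 1 (y := y / w) (by positivity)
    ((div_lt_one hw0).mpr hyw) a).tendsto_atTop_zero).const_mul K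
  rw [mul_zero] at hlim
  exact squeeze_zero (fun n => centralBetaCDF_nonneg (by positivity) hb hy0.le hy1) hbound hlim

theorem hasSum_poissonWeight (u : ℝ) :
    HasSum (fun j : ℕ => 1 / (j.factorial : ℝ) * u ^ j) (Real.exp u) := by
  rw [Real.exp_eq_exp_ℝ]
  refine (NormedSpace.expSeries_div_hasSum_exp (𝔸 := ℝ) u).congr_fun fun j => ?_
  ring

theorem summable_noncentralBetaCDF {p q x y : ℝ} (hp : 0 < p) (hq : 0 < q) (hx : 0 ≤ x)
    (hy0 : 0 ≤ y) (hy1 : y < 1) :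
    Summable fun j : ℕ => 1 / (j.factorial : ℝ) * (x / 2) ^ j * centralBetaCDF (p + j) q y := by
  refine Summable.of_nonneg_of_le (fun j => ?_) (fun j => ?_)
    ((hasSum_poissonWeight (x / 2)).summable.mul_right (centralBetaCDF p q y))
  · have := centralBetaCDF_nonneg (a := p + j) (by positivity) hq hy0 hy1
    positivity
  · have := centralBetaCDF_add_natCast_le hp hq hy0 hy1 j
    gcongr

theorem noncentralBetaCDF_nonneg {p q x y : ℝ} (hp : 0 < p) (hq : 0 < q) (hx : 0 ≤ x)
    (hy0 : 0 ≤ y) (hy1 : y < 1) : 0 ≤ noncentralBetaCDF p q x y := by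
  refine mul_nonneg (Real.exp_pos _).le (tsum_nonneg fun j => ?_)
  have := centralBetaCDF_nonneg (a := p + j) (by positivity) hq hy0 hy1
  positivity

theorem noncentralBetaCDF_le_centralBetaCDF {p q x y : ℝ} (hp : 0 < p) (hq : 0 < q) (hx : 0 ≤ x)
    (hy0 : 0 ≤ y) (hy1 : y < 1) : noncentralBetaCDF p q x y ≤ centralBetaCDF p q y := by
  have h1 := (hasSum_poissonWeight (x / 2)).mul_right (centralBetaCDF p q y)
  have h2 : ∑' j : ℕ, 1 / (j.factorial : ℝ) * (x / 2) ^ j * centralBetaCDF (p + j) q y ≤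
      Real.exp (x / 2) * centralBetaCDF p q y := by
    rw [← h1.tsum_eq]
    refine (summable_noncentralBetaCDF hp hq hx hy0 hy1).tsum_le_tsum (fun j => ?_) h1.summable
    have := centralBetaCDF_add_natCast_le hp hq hy0 hy1 j
    gcongr
  refine (mul_le_mul_of_nonneg_left h2 (Real.exp_pos _).le).trans_eq ?_
  rw [← mul_assoc, ← Real.exp_add, neg_div, neg_add_cancel, Real.exp_zero, one_mul]

theorem tendsto_noncentralBetaCDF_add_natCast {p q x y : ℝ} (hp : 0 < p) (hq : 0 < q)
    (hx : 0 ≤ x) (hy0 : 0 < y) (hy1 : y < 1) :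
    Tendsto (fun n : ℕ => noncentralBetaCDF (p + n) q x y) atTop (𝓝 0) :=
  squeeze_zero (fun _ => noncentralBetaCDF_nonneg (by positivity) hq hx hy0.le hy1)
    (fun _ => noncentralBetaCDF_le_centralBetaCDF (by positivity) hq hx hy0.le hy1)
    (tendsto_centralBetaCDF_add_natCast hp hq hy0 hy1)

theorem hasSum_noncentralBetaCDF_sub {p q x y : ℝ} (hp : 0 < p) (hq : 0 < q)
    (hx : 0 ≤ x) (hy0 : 0 < y) (hy1 : y < 1) :
    HasSum (fun j => y ^ p * (1 - y) ^ q / Real.Gamma q * kummerTerm q (p + q) (x * y / 2) j)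
      (Real.exp (x / 2) * (noncentralBetaCDF p q x y - noncentralBetaCDF (p + 1) q x y)) := by
  have h1 := (summable_noncentralBetaCDF hp hq hx hy0.le hy1).hasSum
  have h2 := (summable_noncentralBetaCDF (p := p + 1) (by linarith) hq hx hy0.le hy1).hasSum
  have h3 : Real.exp (x / 2) * (noncentralBetaCDF p q x y - noncentralBetaCDF (p + 1) q x y) =
      (∑' j : ℕ, 1 / (j.factorial : ℝ) * (x / 2) ^ j * centralBetaCDF (p + j) q y) -
        ∑' j : ℕ, 1 / (j.factorial : ℝ) * (x / 2) ^ j * centralBetaCDF (p + 1 + j) q y := by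
    rw [noncentralBetaCDF, noncentralBetaCDF, ← mul_sub, ← mul_assoc, ← Real.exp_add, neg_div,
      add_neg_cancel, Real.exp_zero, one_mul]
  rw [h3]
  refine (h1.sub h2).congr_fun fun j => ?_
  have e := centralBetaCDF_eq_add (a := p + j) (by positivity) hq hy0.le hy1
  rw [e, kummerTerm, show p + 1 + (j : ℝ) = p + j + 1 by ring,
    show p + q + (j : ℝ) + 1 - q = p + j + 1 by ring, show p + q + (j : ℝ) = p + j + q by ring,
    Real.rpow_add hy0, Real.rpow_natCast, show x * y / 2 = x / 2 * y by ring, mul_pow]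
  ring

/-- Read off from the telescoped series with `p = a-q`, `y = 1/2`, `x = 4z`, for which `xy/2 = z`.
-/
theorem summable_kummerTerm {q a z : ℝ} (hq : 0 < q) (ha : q < a) (hz : 0 ≤ z) :
    Summable (kummerTerm q a z) := by
  have h := (hasSum_noncentralBetaCDF_sub (p := a - q) (q := q) (x := 4 * z) (y := 1 / 2)
    (by linarith) hq (by positivity) (by norm_num) (by norm_num)).summable
  have hg := Real.Gamma_pos_of_pos hq
  have hpos : (1 / 2 : ℝ) ^ (a - q) * (1 - 1 / 2) ^ q / Real.Gamma q ≠ 0 := by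
    have h1 := Real.rpow_pos_of_pos (x := 1 / 2) (by norm_num) (a - q)
    have h2 := Real.rpow_pos_of_pos (x := 1 - 1 / 2) (by norm_num) q
    positivity
  rw [summable_mul_left_iff hpos, sub_add_cancel, show 4 * z * (1 / 2) / 2 = z by ring] at h
  exact h

theorem noncentralBetaCDF_sub {p q x y : ℝ} (hp : 0 < p) (hq : 0 < q)
    (hx : 0 ≤ x) (hy0 : 0 < y) (hy1 : y < 1) :
    noncentralBetaCDF p q x y - noncentralBetaCDF (p + 1) q x y =
      Real.exp (-(1 - y) * x / 2) * (y ^ p * (1 - y) ^ q / Real.Gamma q) *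
        scaledKummer q (p + q) (x * y / 2) := by
  have h := (hasSum_noncentralBetaCDF_sub hp hq hx hy0 hy1).tsum_eq
  rw [tsum_mul_left] at h
  have e : Real.exp (-(1 - y) * x / 2) = Real.exp (-(x / 2)) * Real.exp (x * y / 2) := by
    rw [← Real.exp_add]
    ring_nf
  have e2 : Real.exp (x * y / 2) * Real.exp (-(x * y / 2)) = 1 := by
    rw [← Real.exp_add, add_neg_cancel, Real.exp_zero]
  have e3 : Real.exp (-(x / 2)) * Real.exp (x / 2) = 1 := by
    rw [← Real.exp_add, neg_add_cancel, Real.exp_zero]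
  rw [scaledKummer, e]
  linear_combination (-Real.exp (-(x / 2))) * h -
    Real.exp (-(x / 2)) * (y ^ p * (1 - y) ^ q / Real.Gamma q) *
      (∑' j, kummerTerm q (p + q) (x * y / 2) j) * e2 -
    (noncentralBetaCDF p q x y - noncentralBetaCDF (p + 1) q x y) * e3

theorem scaledKummer_nonneg {q a z : ℝ} (ha : 0 ≤ a) (hqa : q ≤ a + 1) (hz : 0 ≤ z) :
    0 ≤ scaledKummer q a z :=
  mul_nonneg (Real.exp_pos _).le (tsum_nonneg (kummerTerm_nonneg ha hqa hz))

/-- The noncentral beta distribution function as a power series in `y` with Kummer functions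
as coefficients. -/
theorem hasSum_noncentralBetaCDF {p q x y : ℝ} (hp : 0 < p) (hq : 0 < q)
    (hx : 0 ≤ x) (hy0 : 0 < y) (hy1 : y < 1) :
    HasSum (fun m : ℕ => Real.exp (-(1 - y) * x / 2) * (y ^ p * (1 - y) ^ q / Real.Gamma q) *
      (y ^ m * scaledKummer q (p + q + m) (x * y / 2))) (noncentralBetaCDF p q x y) := by
  have hg := Real.Gamma_pos_of_pos hq
  -- The terms are nonnegative, so the limit of the telescoping partial sums suffices.
  rw [hasSum_iff_tendsto_nat_of_nonneg]
  · have hstep (m : ℕ) : Real.exp (-(1 - y) * x / 2) * (y ^ p * (1 - y) ^ q / Real.Gamma q) *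
        (y ^ m * scaledKummer q (p + q + m) (x * y / 2)) =
        noncentralBetaCDF (p + m) q x y - noncentralBetaCDF (p + (m + 1 : ℕ)) q x y := by
      push_cast
      rw [← add_assoc, noncentralBetaCDF_sub (by positivity) hq hx hy0 hy1, Real.rpow_add hy0,
        Real.rpow_natCast, add_right_comm]
      ring
    simp_rw [hstep, Finset.sum_range_sub' fun m : ℕ => noncentralBetaCDF (p + m) q x y]
    simpa using (tendsto_noncentralBetaCDF_add_natCast hp hq hx hy0 hy1).const_sub
      (noncentralBetaCDF p q x y)
  · intro m
    have h1 := Real.rpow_nonneg (x := 1 - y) (by linarith) q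
    have h2 := scaledKummer_nonneg (q := q) (a := p + q + m) (z := x * y / 2) (by positivity)
      (by linarith [m.cast_nonneg (α := ℝ)]) (by positivity)
    positivity

/-- The expansion terminates and is exact for positive integers `q`. -/
theorem kummerRemainder_natCast (k : ℕ) {a z : ℝ} (hz : 0 < z) (ha : (k : ℝ) + 1 < a) :
    kummerRemainder (k + 1) ((k : ℝ) + 1) a z = 0 := by
  induction k generalizing a with
  | zero =>
    rw [Nat.cast_zero, zero_add] at ha
    simpa using kummerRemainder_one 0 (zero_lt_one.trans ha) z
  | succ k ih =>
    push_cast at ha ⊢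
    have hk : (0 : ℝ) ≤ k := k.cast_nonneg
    have h1 := kummerRemainder_add_one (k + 1) (a := a - 1) (q := k + 1) (by linarith) hz
      (summable_kummerTerm (by linarith) (by linarith) hz.le)
      (summable_kummerTerm (by linarith) (by linarith) hz.le)
    -- The additional term carries `(-k)_{k+1} = 0`, so both remainders in the recurrence fall under
    -- the induction hypothesis.
    have h2 : kummerRemainder (k + 1 + 1) ((k : ℝ) + 1) a z =
        kummerRemainder (k + 1) ((k : ℝ) + 1) a z := by
      have := pochhammerSymbol_one_sub_natCast_eq_zero (k := k + 1) (n := k + 1) (by omega) le_rfl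
      push_cast at this
      rw [kummerRemainder, Finset.sum_range_succ, kummerRemainder, this]
      ring
    rw [sub_add_cancel, h2, ih (by linarith), ih (by linarith)] at h1
    simpa using h1

/-! ### Taylor remainders of a power -/

theorem hasDerivAt_powerTaylorRemainder (N : ℕ) (a : ℝ) {s : ℝ} (hs : s < 1) :
    HasDerivAt (fun s : ℝ => (1 - s) ^ (a - 1) -
        ∑ n ∈ Finset.range (N + 1), powerTaylorCoeff n a * s ^ n)
      ((1 - a) * ((1 - s) ^ (a - 1 - 1) -
        ∑ n ∈ Finset.range N, powerTaylorCoeff n (a - 1) * s ^ n)) s := by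
  have h1 := ((hasDerivAt_id s).const_sub 1).rpow_const (p := a - 1)
    (Or.inl (by simp only [id]; linarith))
  have h2 : HasDerivAt (fun s : ℝ => ∑ n ∈ Finset.range N, powerTaylorCoeff (n + 1) a * s ^ (n + 1))
      (∑ n ∈ Finset.range N, (1 - a) * (powerTaylorCoeff n (a - 1) * s ^ n)) s := by
    refine HasDerivAt.fun_sum fun n _ => ?_
    refine ((hasDerivAt_pow (n + 1) s).const_mul _).congr_deriv ?_
    have := succ_mul_powerTaylorCoeff_succ n a
    push_cast
    linear_combination s ^ n * this
  have h3 := h1.sub (h2.add_const (powerTaylorCoeff 0 a * s ^ 0))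
  refine (h3.congr_of_eventuallyEq (Eventually.of_forall fun t => ?_)).congr_deriv ?_
  · simp [Finset.sum_range_succ', powerTaylorCoeff_zero]
  · rw [← Finset.mul_sum]
    simp only [id]
    ring

/-- Apply the mean value inequality `N` times. Each derivative lowers `a` and `N` together, so `a -
N` is unchanged; `L` dominates every factor `|1-a|` that appears, and `2^(K+1)` bounds the power
left at the end. -/
theorem abs_powerTaylorRemainder_le_of_le_half (N K : ℕ) {a L s : ℝ} (hK : -(K : ℝ) ≤ a - N)
    (hL : |a| + N + 1 ≤ L) (hs0 : 0 ≤ s) (hs : s ≤ 1 / 2) :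
    |(1 - s) ^ (a - 1) - ∑ n ∈ Finset.range N, powerTaylorCoeff n a * s ^ n| ≤
      2 ^ (K + 1) * L ^ N * s ^ N := by
  induction N generalizing a s with
  | zero =>
    have hs1 : 0 < 1 - s := by linarith
    simp only [Finset.range_zero, Finset.sum_empty, sub_zero, pow_zero, mul_one]
    rw [abs_of_nonneg (Real.rpow_nonneg hs1.le _)]
    simp only [Nat.cast_zero, sub_zero] at hK
    calc (1 - s) ^ (a - 1) ≤ (1 - s) ^ (-((K + 1 : ℕ) : ℝ)) :=
          Real.rpow_le_rpow_of_exponent_ge hs1 (by linarith) (by push_cast; linarith)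
      _ ≤ (1 / 2) ^ (-((K + 1 : ℕ) : ℝ)) :=
          Real.rpow_le_rpow_of_nonpos (by norm_num) (by linarith)
            (neg_nonpos.mpr (Nat.cast_nonneg _))
      _ = 2 ^ (K + 1) := by
          rw [one_div, Real.inv_rpow (by norm_num), Real.rpow_neg (by norm_num), inv_inv,
            Real.rpow_natCast]
  | succ N ih =>
    push_cast at hK hL
    have ha := abs_nonneg a
    have hN : (0 : ℝ) ≤ N := N.cast_nonneg
    have h1a : |1 - a| ≤ L := by
      have := abs_sub 1 a
      rw [abs_one] at this
      linarith
    have ha1 : |a - 1| ≤ |a| + 1 := by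
      have := abs_sub a 1
      rwa [abs_one] at this
    have hL0 : 0 ≤ L := by linarith
    have hmvt := norm_image_sub_le_of_norm_deriv_le_segment' (a := 0) (b := s)
      (C := L * (2 ^ (K + 1) * L ^ N * s ^ N))
      (fun u hu => (hasDerivAt_powerTaylorRemainder N a
        (show u < 1 by linarith [hu.2])).hasDerivWithinAt) (fun u hu => ?_) s ⟨hs0, le_rfl⟩
    · simp only [sub_zero, Real.one_rpow] at hmvt
      rw [Finset.sum_range_succ' (fun n => powerTaylorCoeff n a * 0 ^ n)] at hmvt
      simp only [powerTaylorCoeff_zero, ne_eq, Nat.add_eq_zero_iff, one_ne_zero, and_false,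
        not_false_eq_true, zero_pow, mul_zero, Finset.sum_const_zero, pow_zero, mul_one, zero_add,
        sub_self, sub_zero, Real.norm_eq_abs] at hmvt
      refine hmvt.trans_eq ?_
      ring
    · rw [norm_mul, Real.norm_eq_abs, Real.norm_eq_abs]
      have h := ih (a := a - 1) (s := u) (by linarith) (by linarith) hu.1 (by linarith [hu.2])
      have hu0 : 0 ≤ u := hu.1
      have hus : u ≤ s := hu.2.le
      refine mul_le_mul h1a (h.trans ?_) (abs_nonneg _) hL0
      gcongr

/-- The function `(1 - s) ^ (a - 1)` on `s < 1`, extended by zero. -/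
noncomputable def truncatedPower (a s : ℝ) : ℝ :=
  Set.indicator (Set.Iio 1) (fun s : ℝ => (1 - s) ^ (a - 1)) s

theorem truncatedPower_nonneg (a s : ℝ) : 0 ≤ truncatedPower a s :=
  Set.indicator_nonneg (fun t (ht : t < 1) => Real.rpow_nonneg (by linarith) _) s

/-- For `s > 1/2` each monomial is at most `(2s)^N`, but the power is unbounded near `s = 1` when `a
< 1`; it is kept as a separate term, to be integrated. -/
theorem abs_truncatedPower_sub_le (N : ℕ) {a s : ℝ} (ha : 0 < a) (hs : 0 < s) :
    |truncatedPower a s - ∑ n ∈ Finset.range N, powerTaylorCoeff n a * s ^ n| ≤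
      (2 ^ (N + 1) * (N + 1) ^ N + N * 2 ^ N) * (1 + a) ^ N * s ^ N +
        Set.indicator (Set.Ioi (1 / 2)) (truncatedPower a) s := by
  have hN : (0 : ℝ) ≤ N := N.cast_nonneg
  have h1a : 1 ≤ 1 + a := by linarith
  have ht := truncatedPower_nonneg a s
  rcases le_or_gt s (1 / 2) with h | h
  · have hlt : s ∈ Set.Iio (1 : ℝ) := by
      rw [Set.mem_Iio]
      linarith
    have hb := abs_powerTaylorRemainder_le_of_le_half N N (a := a) (L := (N + 1) * (1 + a))
      (by linarith) (by rw [abs_of_pos ha]; nlinarith) hs.le h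
    rw [truncatedPower, Set.indicator_of_mem hlt,
      Set.indicator_of_notMem (by rw [Set.mem_Ioi]; linarith), add_zero]
    refine hb.trans ?_
    rw [mul_pow, ← mul_assoc]
    gcongr
    have : (0 : ℝ) ≤ N * 2 ^ N := by positivity
    linarith
  · rw [Set.indicator_of_mem (Set.mem_Ioi.mpr h)]
    have hsum : |∑ n ∈ Finset.range N, powerTaylorCoeff n a * s ^ n| ≤
        N * 2 ^ N * (1 + a) ^ N * s ^ N := by
      refine (Finset.abs_sum_le_sum_abs _ _).trans ?_
      have hterm : ∀ n ∈ Finset.range N,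
          |powerTaylorCoeff n a * s ^ n| ≤ (1 + a) ^ N * (2 ^ N * s ^ N) := by
        intro n hn
        have hn' : n ≤ N := (Finset.mem_range.mp hn).le
        rw [abs_mul, abs_of_nonneg (pow_nonneg hs.le n)]
        refine mul_le_mul ((abs_powerTaylorCoeff_le n ha.le).trans
          (pow_le_pow_right₀ h1a hn')) ?_ (by positivity) (by positivity)
        rw [← mul_pow]
        exact (pow_le_pow_left₀ hs.le (by linarith) n).trans
          (pow_le_pow_right₀ (by linarith) hn')
      refine (Finset.sum_le_card_nsmul _ _ _ hterm).trans_eq ?_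
      rw [Finset.card_range, nsmul_eq_mul]
      ring
    have h1 := abs_sub (truncatedPower a s) (∑ n ∈ Finset.range N, powerTaylorCoeff n a * s ^ n)
    rw [abs_of_nonneg ht] at h1
    have h2 : N * 2 ^ N * (1 + a) ^ N * s ^ N ≤
        (2 ^ (N + 1) * (N + 1 : ℝ) ^ N + N * 2 ^ N) * (1 + a) ^ N * s ^ N := by
      gcongr
      have : (0 : ℝ) ≤ 2 ^ (N + 1) * (N + 1 : ℝ) ^ N := by positivity
      linarith
    linarith

/-! ### Beta integrals over the half line -/

theorem ofReal_betaDensity {u v s : ℝ} (hs : s ∈ Set.Ioo (0 : ℝ) 1) :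
    (s : ℂ) ^ ((u : ℂ) - 1) * (1 - (s : ℂ)) ^ ((v : ℂ) - 1) =
      ((s ^ (u - 1) * (1 - s) ^ (v - 1) : ℝ) : ℂ) := by
  have h1 : 0 ≤ 1 - s := by linarith [hs.2]
  push_cast
  rw [Complex.ofReal_cpow hs.1.le, Complex.ofReal_cpow h1]
  push_cast
  rfl

theorem integrableOn_betaDensity {u v : ℝ} (hu : 0 < u) (hv : 0 < v) :
    IntegrableOn (fun s : ℝ => s ^ (u - 1) * (1 - s) ^ (v - 1)) (Set.Ioo 0 1) := by
  have h := Complex.betaIntegral_convergent (u := u) (v := v) (by simpa) (by simpa)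
  rw [intervalIntegrable_iff_integrableOn_Ioo_of_le zero_le_one] at h
  have h2 := (integrableOn_congr_fun (fun _ => ofReal_betaDensity) measurableSet_Ioo).mp h
  exact h2.re

theorem integral_betaDensity {u v : ℝ} (hu : 0 < u) (hv : 0 < v) :
    ∫ s in Set.Ioo (0 : ℝ) 1, s ^ (u - 1) * (1 - s) ^ (v - 1) =
      Real.Gamma u * Real.Gamma v / Real.Gamma (u + v) := by
  have h := ProbabilityTheory.beta_eq_betaIntegralReal u v hu hv
  rw [Complex.betaIntegral, intervalIntegral.integral_of_le zero_le_one, integral_Ioc_eq_integral_Ioo,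
    setIntegral_congr_fun measurableSet_Ioo (fun _ => ofReal_betaDensity),
    integral_complex_ofReal, Complex.ofReal_re] at h
  exact h.symm

theorem rpow_mul_truncatedPower (q a : ℝ) :
    (fun s : ℝ => s ^ (-q) * truncatedPower a s) =
      Set.indicator (Set.Iio 1) fun s : ℝ => s ^ (1 - q - 1) * (1 - s) ^ (a - 1) := by
  funext s
  rw [truncatedPower, sub_sub_cancel_left]
  by_cases hs : s ∈ Set.Iio (1 : ℝ)
  · rw [Set.indicator_of_mem hs, Set.indicator_of_mem hs]
  · rw [Set.indicator_of_notMem hs, Set.indicator_of_notMem hs, mul_zero]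

theorem integrableOn_rpow_mul_truncatedPower {q a : ℝ} (hq : q < 1) (ha : 0 < a) :
    IntegrableOn (fun s : ℝ => s ^ (-q) * truncatedPower a s) (Set.Ioi 0) := by
  rw [rpow_mul_truncatedPower, IntegrableOn, integrable_indicator_iff measurableSet_Iio,
    IntegrableOn, Measure.restrict_restrict measurableSet_Iio, Set.Iio_inter_Ioi]
  exact integrableOn_betaDensity (by linarith) ha

theorem integral_rpow_mul_truncatedPower {q a : ℝ} (hq : q < 1) (ha : 0 < a) :
    ∫ s in Set.Ioi (0 : ℝ), s ^ (-q) * truncatedPower a s =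
      Real.Gamma (1 - q) * Real.Gamma a / Real.Gamma (a + 1 - q) := by
  rw [rpow_mul_truncatedPower, integral_indicator measurableSet_Iio,
    Measure.restrict_restrict measurableSet_Iio, Set.Iio_inter_Ioi,
    integral_betaDensity (by linarith) ha, show 1 - q + a = a + 1 - q by ring]

theorem truncatedPower_add_natCast (a s : ℝ) (j : ℕ) :
    truncatedPower (a + j) s = (1 - s) ^ j * truncatedPower a s := by
  rw [truncatedPower, truncatedPower]
  by_cases h : s ∈ Set.Iio (1 : ℝ)
  · have h1 : 0 < 1 - s := by linarith [Set.mem_Iio.mp h]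
    rw [Set.indicator_of_mem h, Set.indicator_of_mem h, show a + j - 1 = j + (a - 1) by ring,
      Real.rpow_add h1, Real.rpow_natCast]
  · rw [Set.indicator_of_notMem h, Set.indicator_of_notMem h, mul_zero]

theorem integrableOn_exp_mul_rpow_mul_truncatedPower {q a z : ℝ} (hq : q < 1) (ha : 0 < a)
    (hz : 0 ≤ z) :
    IntegrableOn (fun s : ℝ => Real.exp (-(z * s)) * (s ^ (-q) * truncatedPower a s))
      (Set.Ioi 0) := by
  refine (integrableOn_rpow_mul_truncatedPower hq ha).bdd_mul (c := 1) ?_ ?_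
  · exact (by fun_prop : Continuous fun s : ℝ => Real.exp (-(z * s))).aestronglyMeasurable
  · refine (ae_restrict_mem measurableSet_Ioi).mono fun s hs => ?_
    have hs0 : 0 < s := hs
    rw [Real.norm_of_nonneg (Real.exp_pos _).le, Real.exp_le_one_iff]
    have : 0 ≤ z * s := by positivity
    linarith

/-- Expand `e^{-zs} = e^{-z} e^{z(1-s)}` in powers of `1-s` and integrate termwise by the Beta
integral. The terms are nonnegative and serve as their own dominating series. -/
theorem scaledKummer_eq_integral {q a z : ℝ} (hq : q < 1) (ha : 0 < a) (hz : 0 ≤ z) :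
    scaledKummer q a z = 1 / Real.Gamma (1 - q) *
      ∫ s in Set.Ioi (0 : ℝ), Real.exp (-(z * s)) * (s ^ (-q) * truncatedPower a s) := by
  have hg := Real.Gamma_pos_of_pos (s := 1 - q) (by linarith)
  have hsum (s : ℝ) : HasSum
      (fun j : ℕ => z ^ j / (j.factorial : ℝ) * ((1 - s) ^ j * (s ^ (-q) * truncatedPower a s)))
      (Real.exp z * (Real.exp (-(z * s)) * (s ^ (-q) * truncatedPower a s))) := by
    have h := (hasSum_poissonWeight (z * (1 - s))).mul_right (s ^ (-q) * truncatedPower a s)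
    rw [mul_sub, mul_one, sub_eq_add_neg, Real.exp_add, mul_assoc] at h
    refine h.congr_fun fun j => ?_
    rw [← sub_eq_add_neg, ← mul_one_sub, mul_pow]
    ring
  have hnonneg (j : ℕ) {s : ℝ} (hs : 0 < s) :
      0 ≤ z ^ j / (j.factorial : ℝ) * (s ^ (-q) * truncatedPower (a + j) s) := by
    have := truncatedPower_nonneg (a + j) s
    positivity
  have hall (s : ℝ) : HasSum
      (fun j : ℕ => z ^ j / (j.factorial : ℝ) * (s ^ (-q) * truncatedPower (a + j) s))
      (Real.exp z * (Real.exp (-(z * s)) * (s ^ (-q) * truncatedPower a s))) := by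
    refine (hsum s).congr_fun fun j => ?_
    rw [truncatedPower_add_natCast]
    ring
  have key := hasSum_integral_of_dominated_convergence (μ := volume.restrict (Set.Ioi (0 : ℝ)))
    (F := fun (j : ℕ) s => z ^ j / (j.factorial : ℝ) * (s ^ (-q) * truncatedPower (a + j) s))
    (f := fun s => Real.exp z * (Real.exp (-(z * s)) * (s ^ (-q) * truncatedPower a s)))
    (fun (j : ℕ) s => z ^ j / (j.factorial : ℝ) * (s ^ (-q) * truncatedPower (a + j) s))
    (fun j => ((integrableOn_rpow_mul_truncatedPower (a := a + j) hq
      (by positivity)).const_mul _).aestronglyMeasurable)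
    (fun j => (ae_restrict_mem measurableSet_Ioi).mono fun s hs =>
      (Real.norm_of_nonneg (hnonneg j hs)).le)
    (ae_of_all _ fun s => (hall s).summable)
    (((integrableOn_exp_mul_rpow_mul_truncatedPower hq ha hz).const_mul _).congr
      (ae_of_all _ fun s => (hall s).tsum_eq.symm))
    (ae_of_all _ hall)
  have hk : HasSum (fun j => Real.Gamma (1 - q) * kummerTerm q a z j)
      (∫ s in Set.Ioi (0 : ℝ),
        Real.exp z * (Real.exp (-(z * s)) * (s ^ (-q) * truncatedPower a s))) := by
    refine key.congr_fun fun j => ?_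
    rw [integral_const_mul, integral_rpow_mul_truncatedPower hq (by positivity), kummerTerm]
    ring
  have h := hk.tsum_eq
  rw [tsum_mul_left, integral_const_mul] at h
  have e : Real.exp (-z) * Real.exp z = 1 := by
    rw [← Real.exp_add, neg_add_cancel, Real.exp_zero]
  rw [scaledKummer, one_div_mul_eq_div, eq_div_iff hg.ne']
  linear_combination Real.exp (-z) * h + (∫ s in Set.Ioi (0 : ℝ),
    Real.exp (-(z * s)) * (s ^ (-q) * truncatedPower a s)) * e

/-! ### Uniform remainder bounds for the Kummer-type series -/

/-- `u Γ(u) = Γ(u+1)` is at least the minimum of `Γ` on `[1,2]`. This keeps `1/Γ(1-q)` bounded up to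
`q = 1`. -/
theorem exists_pos_le_Gamma : ∃ c : ℝ, 0 < c ∧ ∀ u : ℝ, 0 < u → u < 1 → c ≤ Real.Gamma u := by
  have hcont : ContinuousOn Real.Gamma (Set.Icc 1 2) := fun s hs =>
    (Real.differentiableAt_Gamma fun m h => by
      linarith [hs.1, m.cast_nonneg (α := ℝ)]).continuousAt.continuousWithinAt
  obtain ⟨v, hv, hmin⟩ := isCompact_Icc.exists_isMinOn (Set.nonempty_Icc.mpr one_le_two) hcont
  refine ⟨Real.Gamma v, Real.Gamma_pos_of_pos (by linarith [hv.1]), fun u hu0 hu1 => ?_⟩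
  have h1 : Real.Gamma v ≤ Real.Gamma (u + 1) := hmin ⟨by linarith, by linarith⟩
  rw [Real.Gamma_add_one hu0.ne'] at h1
  have := Real.Gamma_pos_of_pos hu0
  nlinarith

theorem Gamma_add_natCast_eq {u : ℝ} (hu : 0 < u) (n : ℕ) :
    Real.Gamma (u + n) = pochhammerSymbol u n * Real.Gamma u := by
  induction n with
  | zero => simp [pochhammerSymbol_zero]
  | succ n ih =>
    push_cast
    rw [← add_assoc, Real.Gamma_add_one (by positivity), ih, pochhammerSymbol_succ]
    ring

theorem pochhammerSymbol_le_factorial {u : ℝ} (hu0 : 0 ≤ u) (hu1 : u ≤ 1) (n : ℕ) :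
    0 ≤ pochhammerSymbol u n ∧ pochhammerSymbol u n ≤ n.factorial := by
  induction n with
  | zero => simp [pochhammerSymbol_zero]
  | succ n ih =>
    rw [pochhammerSymbol_succ, Nat.factorial_succ, mul_comm (n + 1)]
    push_cast
    have hn : (0 : ℝ) ≤ n := n.cast_nonneg
    exact ⟨mul_nonneg ih.1 (by linarith),
      mul_le_mul ih.2 (by linarith) (by linarith) (Nat.cast_nonneg _)⟩

theorem exp_mul_rpow_mul_pow (q z : ℝ) (n : ℕ) : Set.EqOn
    (fun s : ℝ => Real.exp (-(z * s)) * (s ^ (-q) * s ^ n))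
    (fun s : ℝ => s ^ (n + 1 - q - 1) * Real.exp (-(z * s))) (Set.Ioi 0) := fun s hs => by
  have hs0 : (0 : ℝ) < s := hs
  simp only
  rw [show n + 1 - q - 1 = -q + n by ring, Real.rpow_add hs0, Real.rpow_natCast, mul_comm]

theorem integrableOn_exp_mul_rpow_mul_pow {q z : ℝ} (hq : q < 1) (hz : 0 < z) (n : ℕ) :
    IntegrableOn (fun s : ℝ => Real.exp (-(z * s)) * (s ^ (-q) * s ^ n)) (Set.Ioi 0) := by
  rw [integrableOn_congr_fun (exp_mul_rpow_mul_pow q z n) measurableSet_Ioi]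
  have hn : (0 : ℝ) ≤ n := n.cast_nonneg
  simpa [neg_mul] using integrableOn_rpow_mul_exp_neg_mul_rpow (p := 1) (s := n + 1 - q - 1)
    (b := z) (by linarith) one_pos hz

theorem integral_exp_mul_rpow_mul_pow {q z : ℝ} (hq : q < 1) (hz : 0 < z) (n : ℕ) :
    ∫ s in Set.Ioi (0 : ℝ), Real.exp (-(z * s)) * (s ^ (-q) * s ^ n) =
      Real.Gamma (1 - q) * (z ^ (q - 1 - n) * pochhammerSymbol (1 - q) n) := by
  have hn : (0 : ℝ) ≤ n := n.cast_nonneg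
  rw [setIntegral_congr_fun measurableSet_Ioi (exp_mul_rpow_mul_pow q z n),
    Real.integral_rpow_mul_exp_neg_mul_Ioi (by linarith) hz,
    show n + 1 - q = 1 - q + n by ring, Gamma_add_natCast_eq (by linarith),
    one_div, Real.inv_rpow hz.le, ← Real.rpow_neg hz.le, show -(1 - q + n) = q - 1 - n by ring]
  ring

theorem kummerRemainder_eq_integral (N : ℕ) {q a z : ℝ} (hq : q < 1) (ha : 0 < a) (hz : 0 < z) :
    kummerRemainder N q a z = 1 / Real.Gamma (1 - q) *
      ∫ s in Set.Ioi (0 : ℝ), Real.exp (-(z * s)) * (s ^ (-q) *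
        (truncatedPower a s - ∑ n ∈ Finset.range N, powerTaylorCoeff n a * s ^ n)) := by
  have hg := Real.Gamma_pos_of_pos (s := 1 - q) (by linarith)
  have hsum : ∀ n ∈ Finset.range N, Integrable
      (fun s : ℝ => powerTaylorCoeff n a * (Real.exp (-(z * s)) * (s ^ (-q) * s ^ n)))
      (volume.restrict (Set.Ioi 0)) := fun n _ =>
    (integrableOn_exp_mul_rpow_mul_pow hq hz n).const_mul _
  have hsplit : (fun s : ℝ => Real.exp (-(z * s)) * (s ^ (-q) *
        (truncatedPower a s - ∑ n ∈ Finset.range N, powerTaylorCoeff n a * s ^ n))) =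
      fun s => Real.exp (-(z * s)) * (s ^ (-q) * truncatedPower a s) -
        ∑ n ∈ Finset.range N,
          powerTaylorCoeff n a * (Real.exp (-(z * s)) * (s ^ (-q) * s ^ n)) := by
    funext s
    rw [mul_sub, mul_sub, Finset.mul_sum, Finset.mul_sum]
    congr 1
    exact Finset.sum_congr rfl fun n _ => by ring
  rw [hsplit, integral_sub (integrableOn_exp_mul_rpow_mul_truncatedPower hq ha hz.le)
    (integrable_finsetSum _ hsum), integral_finsetSum _ hsum, mul_sub,
    ← scaledKummer_eq_integral hq ha hz.le, kummerRemainder, Finset.mul_sum]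
  congr 1
  refine Finset.sum_congr rfl fun n _ => ?_
  rw [integral_const_mul, integral_exp_mul_rpow_mul_pow hq hz]
  field_simp

/-- On `s > 1/2`, `e^{-zs} ≤ e^{-z/2}` and `s^{-q} ≤ 2`. The factor `s^(-0)` puts the tail in the
form of the Beta integral with `q = 0`, whose value is `1/a`. -/
theorem norm_watson_integrand_le (N : ℕ) {q a z s : ℝ} (hq0 : 0 < q) (hq : q < 1) (ha : 0 < a)
    (hz : 0 < z) (hs : 0 < s) :
    ‖Real.exp (-(z * s)) * (s ^ (-q) *
        (truncatedPower a s - ∑ n ∈ Finset.range N, powerTaylorCoeff n a * s ^ n))‖ ≤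
      (2 ^ (N + 1) * (N + 1) ^ N + N * 2 ^ N) * (1 + a) ^ N *
          (Real.exp (-(z * s)) * (s ^ (-q) * s ^ N)) +
        2 * Real.exp (-(z / 2)) * (s ^ (-(0 : ℝ)) * truncatedPower a s) := by
  have hsq := Real.rpow_pos_of_pos hs (-q)
  have hexp := Real.exp_pos (-(z * s))
  have ht := truncatedPower_nonneg a s
  rw [norm_mul, norm_mul, Real.norm_of_nonneg hexp.le, Real.norm_of_nonneg hsq.le,
    Real.norm_eq_abs, neg_zero, Real.rpow_zero, one_mul]
  have h1 : Real.exp (-(z * s)) * (s ^ (-q) * Set.indicator (Set.Ioi (1 / 2)) (truncatedPower a) s)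
      ≤ 2 * Real.exp (-(z / 2)) * truncatedPower a s := by
    by_cases hs2 : s ∈ Set.Ioi (1 / 2 : ℝ)
    · have hs3 : 1 / 2 < s := hs2
      rw [Set.indicator_of_mem hs2, ← mul_assoc, mul_comm (2 : ℝ)]
      refine mul_le_mul_of_nonneg_right (mul_le_mul ?_ ?_ hsq.le (Real.exp_pos _).le) ht
      · rw [Real.exp_le_exp]
        nlinarith
      · calc s ^ (-q) ≤ (1 / 2) ^ (-q) :=
              Real.rpow_le_rpow_of_nonpos (by norm_num) hs3.le (by linarith)
          _ ≤ (1 / 2) ^ (-1 : ℝ) :=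
              Real.rpow_le_rpow_of_exponent_ge (by norm_num) (by norm_num) (by linarith)
          _ = 2 := by rw [Real.rpow_neg_one]; norm_num
    · rw [Set.indicator_of_notMem hs2, mul_zero, mul_zero]
      positivity
  have h2 := mul_le_mul_of_nonneg_left (abs_truncatedPower_sub_le N ha hs)
    (mul_nonneg hexp.le hsq.le)
  rw [mul_assoc] at h2
  refine h2.trans ?_
  rw [mul_add]
  refine add_le_add (le_of_eq ?_) ?_
  · ring
  · rw [mul_assoc]
    exact h1

theorem exp_neg_half_le (N : ℕ) {q z : ℝ} (hq : 0 ≤ q) (hz : 1 ≤ z) :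
    Real.exp (-(z / 2)) ≤ 2 ^ (N + 1) * (N + 1).factorial * z ^ (q - 1 - N) := by
  have hz0 : 0 < z := by linarith
  have h := Real.pow_div_factorial_le_exp (x := z / 2) (by positivity) (N + 1)
  have h1 : (z ^ (N + 1))⁻¹ ≤ z ^ (q - 1 - N) := by
    rw [← Real.rpow_natCast, ← Real.rpow_neg hz0.le]
    refine Real.rpow_le_rpow_of_exponent_le hz ?_
    push_cast
    linarith
  have hf : (0 : ℝ) < (N + 1).factorial := by positivity
  calc Real.exp (-(z / 2)) = (Real.exp (z / 2))⁻¹ := Real.exp_neg _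
    _ ≤ ((z / 2) ^ (N + 1) / (N + 1).factorial)⁻¹ := inv_anti₀ (by positivity) h
    _ = 2 ^ (N + 1) * (N + 1).factorial * (z ^ (N + 1))⁻¹ := by
        rw [div_pow]
        field_simp
    _ ≤ _ := by gcongr

/-- Watson's lemma for `0 < q < 1`, uniformly in `q` and in `a > 0`. -/
theorem exists_kummerRemainder_bound_of_lt_one (N : ℕ) :
    ∃ C : ℝ, 0 ≤ C ∧ ∀ q a z : ℝ, 0 < q → q < 1 → 0 < a → 1 ≤ z →
      a * |kummerRemainder N q a z| ≤ C * (1 + a) ^ (N + 1) * z ^ (q - 1 - N) := by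
  obtain ⟨c, hc, hgc⟩ := exists_pos_le_Gamma
  set D : ℝ := 2 ^ (N + 1) * (N + 1) ^ N + N * 2 ^ N with hD
  have hD0 : 0 ≤ D := by positivity
  set E : ℝ := 2 ^ (N + 1) * (N + 1).factorial with hE
  have hE0 : 0 ≤ E := by positivity
  refine ⟨D * N.factorial + 2 * E / c, by positivity, fun q a z hq0 hq ha hz => ?_⟩
  have hz0 : 0 < z := by linarith
  have hg := Real.Gamma_pos_of_pos (s := 1 - q) (by linarith)
  have hgle := hgc (1 - q) (by linarith) (by linarith)
  have hzp := Real.rpow_pos_of_pos hz0 (q - 1 - N)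
  have hI1 := (integrableOn_exp_mul_rpow_mul_pow hq hz0 N).const_mul (D * (1 + a) ^ N)
  have hI2 := (integrableOn_rpow_mul_truncatedPower zero_lt_one ha).const_mul
    (2 * Real.exp (-(z / 2)))
  have hint := norm_integral_le_of_norm_le (hI1.add hI2)
    ((ae_restrict_mem measurableSet_Ioi).mono fun s hs =>
      norm_watson_integrand_le N hq0 hq ha hz0 hs)
  simp only [Pi.add_apply] at hint
  rw [integral_add hI1 hI2, integral_const_mul, integral_const_mul,
    integral_exp_mul_rpow_mul_pow hq hz0, integral_rpow_mul_truncatedPower zero_lt_one ha,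
    sub_zero, sub_zero, Real.Gamma_one, Real.Gamma_add_one ha.ne', Real.norm_eq_abs] at hint
  have hga := Real.Gamma_pos_of_pos ha
  have hquot : 1 * Real.Gamma a / (a * Real.Gamma a) = 1 / a := by field_simp
  rw [hquot] at hint
  have hp := pochhammerSymbol_le_factorial (u := 1 - q) (by linarith) (by linarith) N
  have hexp := exp_neg_half_le N hq0.le hz
  rw [← hE] at hexp
  rw [kummerRemainder_eq_integral N hq ha hz0, abs_mul, abs_of_pos (one_div_pos.mpr hg)]
  have ha1 : (1 : ℝ) ≤ (1 + a) ^ (N + 1) := one_le_pow₀ (by linarith)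
  -- The factor `a` cancels the tail integral `1/a`, and `Γ(1-q)` cancels in the main part.
  calc a * (1 / Real.Gamma (1 - q) * |_|)
      ≤ a * (1 / Real.Gamma (1 - q) * (D * (1 + a) ^ N *
          (Real.Gamma (1 - q) * (z ^ (q - 1 - N) * pochhammerSymbol (1 - q) N)) +
            2 * Real.exp (-(z / 2)) * (1 / a))) := by gcongr
    _ = D * pochhammerSymbol (1 - q) N * (a * (1 + a) ^ N) * z ^ (q - 1 - N) +
          2 * Real.exp (-(z / 2)) / Real.Gamma (1 - q) := by field_simp
    _ ≤ D * N.factorial * ((1 + a) * (1 + a) ^ N) * z ^ (q - 1 - N) +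
          2 * (E * z ^ (q - 1 - N)) / c := by
        have := hp.1
        have := hp.2
        gcongr
        linarith
    _ = D * N.factorial * (1 + a) ^ (N + 1) * z ^ (q - 1 - N) +
          2 * E / c * z ^ (q - 1 - N) * 1 := by ring
    _ ≤ D * N.factorial * (1 + a) ^ (N + 1) * z ^ (q - 1 - N) +
          2 * E / c * z ^ (q - 1 - N) * (1 + a) ^ (N + 1) := by gcongr
    _ = _ := by ring

theorem const_mul_pow_le {C C' a : ℝ} (M M' : ℕ) (hC : 0 ≤ C) (hC' : 0 ≤ C') (ha : 0 ≤ a) :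
    C * (1 + a) ^ M ≤ (C + C') * (1 + a) ^ (M + M') :=
  mul_le_mul (by linarith) (pow_le_pow_right₀ (by linarith) (by omega)) (by positivity)
    (by positivity)

/-- One step of the remainder recurrence, used with `b = a-1` and `W` the power of `z` belonging to
`q-1`. -/
theorem mul_abs_add_le {a b z u v X Y W : ℝ} (ha : 0 ≤ a) (hb : 0 ≤ b) (hz : 0 ≤ z)
    (hu : a * |u| ≤ X * W) (hv : b * |v| ≤ Y * (z * W)) :
    a * |z * u + b * v| ≤ (X + a * Y) * (z * W) := by
  have h1 := abs_add_le (z * u) (b * v)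
  rw [abs_mul, abs_mul, abs_of_nonneg hz, abs_of_nonneg hb] at h1
  have h2 := mul_le_mul_of_nonneg_left h1 ha
  have h3 := mul_le_mul_of_nonneg_left hu hz
  have h4 := mul_le_mul_of_nonneg_left hv ha
  linarith

/-- The expansion of `scaledKummer` holds uniformly for bounded `q`, with an error that grows
polynomially in `a`. -/
theorem exists_kummerRemainder_bound (K N : ℕ) :
    ∃ (C : ℝ) (M : ℕ), 0 ≤ C ∧ ∀ q a z : ℝ, 0 < q → q ≤ K + 1 → q < a → 1 ≤ z →
      a * |kummerRemainder N q a z| ≤ C * (1 + a) ^ M * z ^ (q - 1 - N) := by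
  induction K generalizing N with
  | zero =>
    obtain ⟨C, hC, h⟩ := exists_kummerRemainder_bound_of_lt_one N
    refine ⟨C + 1, N + 1, by positivity, fun q a z hq0 hq ha hz => ?_⟩
    have hz0 : 0 < z := by linarith
    have ha0 : 0 < a := by linarith
    have hzp := Real.rpow_pos_of_pos hz0 (q - 1 - N)
    rw [Nat.cast_zero, zero_add] at hq
    -- At `q = 1` the integral representation is unavailable, but `F(1,a,z) = 1` is explicit.
    rcases hq.lt_or_eq with hlt | rfl
    · refine (h q a z hq0 hlt ha0 hz).trans ?_
      gcongr
      linarith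
    · cases N with
      | zero =>
        rw [kummerRemainder_zero, scaledKummer_one ha0]
        simp only [abs_one, mul_one, zero_add, pow_one, Nat.cast_zero, sub_self,
          Real.rpow_zero]
        nlinarith
      | succ N =>
        rw [kummerRemainder_one N ha0, abs_zero, mul_zero]
        positivity
  | succ K ih =>
    obtain ⟨C, M, hC, h⟩ := ih N
    have hstep : ∃ (C : ℝ) (M : ℕ), 0 ≤ C ∧ ∀ q a z : ℝ, 1 < q → q ≤ K + 1 + 1 → q < a → 1 ≤ z →
        a * |kummerRemainder N q a z| ≤ C * (1 + a) ^ M * z ^ (q - 1 - N) := by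
      -- For `N = 0` there is no remainder of lower order: `F` itself satisfies the recurrence, and
      -- `z ≥ 1` supplies the missing power. For `N + 1`, the lower-order remainder is larger by one
      -- factor `z`, matching the factor `z` on the other term.
      cases N with
      | zero =>
        refine ⟨C + C, M + (1 + 0), by positivity, fun q a z hq0 hq ha hz => ?_⟩
        have hz0 : 0 < z := by linarith
        have h1 := h (q - 1) a z (by linarith) (by linarith) (by linarith) hz
        have h2 := h (q - 1) (a - 1) z (by linarith) (by linarith) (by linarith) hz
        have hzp := Real.rpow_pos_of_pos hz0 (q - 1 - 1 - (0 : ℕ))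
        have h3 : (a - 1) * |kummerRemainder 0 (q - 1) (a - 1) z| ≤
            C * (1 + a) ^ M * (z * z ^ (q - 1 - 1 - (0 : ℕ))) := by
          refine h2.trans ?_
          have hle : z ^ (q - 1 - 1 - (0 : ℕ)) ≤ z * z ^ (q - 1 - 1 - (0 : ℕ)) :=
            le_mul_of_one_le_left hzp.le hz
          rw [add_sub_cancel]
          have ha0 : 0 < a := by linarith
          gcongr
          linarith
        have h4 := mul_abs_add_le (by linarith) (by linarith) hz0.le h1 h3
        have h5 := scaledKummer_add_one (q := q - 1) (a := a - 1) (z := z) (by linarith)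
          (summable_kummerTerm (by linarith) (by linarith) hz0.le)
          (summable_kummerTerm (by linarith) (by linarith) hz0.le)
        rw [sub_add_cancel, sub_add_cancel] at h5
        simp only [kummerRemainder_zero] at h4 ⊢
        rw [h5]
        refine h4.trans ?_
        have h6 : z * z ^ (q - 1 - 1 - (0 : ℕ)) = z ^ (q - 1 - (0 : ℕ)) := by
          rw [mul_comm, ← Real.rpow_add_one hz0.ne']
          ring_nf
        rw [h6]
        have hpow : C * (1 + a) ^ M + a * (C * (1 + a) ^ M) ≤ (C + C) * (1 + a) ^ (M + (1 + 0)) := by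
          have : 0 ≤ C * (1 + a) ^ (M + 1) := by
            have : 0 < 1 + a := by linarith
            positivity
          rw [add_zero]
          calc _ = C * (1 + a) ^ (M + 1) := by ring
            _ ≤ _ := by linarith
        have := Real.rpow_pos_of_pos hz0 (q - 1 - (0 : ℕ))
        gcongr
      | succ N =>
        obtain ⟨C', M', hC', h'⟩ := ih N
        refine ⟨C + C', M + (M' + 1), by positivity, fun q a z hq0 hq ha hz => ?_⟩
        have hz0 : 0 < z := by linarith
        have ha0 : 0 < a := by linarith
        have h1 := h (q - 1) a z (by linarith) (by linarith) (by linarith) hz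
        have h2 := h' (q - 1) (a - 1) z (by linarith) (by linarith) (by linarith) hz
        have hzp := Real.rpow_pos_of_pos hz0 (q - 1 - 1 - N)
        have hzN : z ^ (q - 1 - 1 - N) = z * z ^ (q - 1 - 1 - (N + 1 : ℕ)) := by
          rw [mul_comm, ← Real.rpow_add_one hz0.ne']
          push_cast
          ring_nf
        have h3 : (a - 1) * |kummerRemainder N (q - 1) (a - 1) z| ≤
            C' * (1 + a) ^ M' * (z * z ^ (q - 1 - 1 - (N + 1 : ℕ))) := by
          rw [← hzN]
          refine h2.trans ?_
          gcongr
          · linarith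
          · linarith
        have h4 := mul_abs_add_le (by linarith) (by linarith) hz0.le h1 h3
        have h5 := kummerRemainder_add_one N (q := q - 1) (a := a - 1) (z := z) (by linarith) hz0
          (summable_kummerTerm (by linarith) (by linarith) hz0.le)
          (summable_kummerTerm (by linarith) (by linarith) hz0.le)
        rw [sub_add_cancel, sub_add_cancel] at h5
        rw [h5]
        refine h4.trans ?_
        rw [← hzN, show q - 1 - ((N + 1 : ℕ) : ℝ) = q - 1 - 1 - N by push_cast; ring]
        have h6 : (1 + a) ^ M ≤ (1 + a) ^ (M + (M' + 1)) :=
          pow_le_pow_right₀ (by linarith) (by omega)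
        have h7 : a * (1 + a) ^ M' ≤ (1 + a) ^ (M + (M' + 1)) := by
          calc a * (1 + a) ^ M' ≤ (1 + a) * (1 + a) ^ M' := by gcongr; linarith
            _ = (1 + a) ^ (M' + 1) := by ring
            _ ≤ _ := pow_le_pow_right₀ (by linarith) (by omega)
        have h8 := mul_le_mul_of_nonneg_left h6 hC
        have h9 := mul_le_mul_of_nonneg_left h7 hC'
        refine mul_le_mul_of_nonneg_right ?_ hzp.le
        linarith
    obtain ⟨C', M', hC', h'⟩ := hstep
    refine ⟨C + C', M + M', by positivity, fun q a z hq0 hq ha hz => ?_⟩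
    have ha0 : 0 ≤ a := by linarith
    have hzp := Real.rpow_pos_of_pos (show 0 < z by linarith) (q - 1 - N)
    push_cast at hq
    rcases le_or_gt q (K + 1) with hle | hgt
    · exact (h q a z hq0 hle ha hz).trans
        (mul_le_mul_of_nonneg_right (const_mul_pow_le M M' hC hC' ha0) hzp.le)
    · have hK : (0 : ℝ) ≤ K := K.cast_nonneg
      refine (h' q a z (by linarith) hq ha hz).trans (mul_le_mul_of_nonneg_right ?_ hzp.le)
      rw [add_comm C, add_comm M]
      exact const_mul_pow_le M' M hC' hC ha0

/-! ### The expansion of the noncentral beta distribution function -/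

/-- Subtract the expansion inside the series over `m`. The `1/(1-y)` from summing the coefficients
turns `(1-y)^q` into `(1-y)^(q-1)`. -/
theorem hasSum_noncentralBetaCDF_sub_expansion (N : ℕ) {p q x y : ℝ} (hp : 0 < p) (hq : 0 < q)
    (hx : 0 < x) (hy0 : 0 < y) (hy1 : y < 1) :
    HasSum (fun m : ℕ => Real.exp (-(1 - y) * x / 2) * (y ^ p * (1 - y) ^ q / Real.Gamma q) *
        (y ^ m * kummerRemainder N q (p + q + m) (x * y / 2)))
      (noncentralBetaCDF p q x y -
        largeZPrefactor p q x y * ∑ n ∈ Finset.range N, largeZTerm p q x y n) := by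
  have hz : 0 < x * y / 2 := by positivity
  have hy : 0 < 1 - y := by linarith
  have h1 := hasSum_noncentralBetaCDF hp hq hx.le hy0 hy1
  have h2 := hasSum_sum (s := Finset.range N) fun n _ =>
    (hasSum_pow_mul_powerTaylorCoeff n (p := p) (q := q) (by positivity) hy0.le hy1).mul_left
      ((x * y / 2) ^ (q - 1 - n) * pochhammerSymbol (1 - q) n)
  have h3 := h1.sub
    (h2.mul_left (Real.exp (-(1 - y) * x / 2) * (y ^ p * (1 - y) ^ q / Real.Gamma q)))
  have e : (Real.exp (-(1 - y) * x / 2) * (y ^ p * (1 - y) ^ q / Real.Gamma q)) *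
        ∑ n ∈ Finset.range N, (x * y / 2) ^ (q - 1 - n) * pochhammerSymbol (1 - q) n *
          ((-1) ^ n * coeffC p q y n / (1 - y)) =
      largeZPrefactor p q x y * ∑ n ∈ Finset.range N, largeZTerm p q x y n := by
    rw [Finset.mul_sum, Finset.mul_sum]
    refine Finset.sum_congr rfl fun n _ => ?_
    rw [largeZPrefactor, largeZTerm, Real.rpow_sub_natCast hz.ne',
      Real.rpow_sub_one hy.ne' q]
    ring
  rw [e] at h3
  refine h3.congr_fun fun m => ?_
  rw [kummerRemainder, mul_sub, mul_sub, Finset.mul_sum]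
  congr 2
  exact Finset.sum_congr rfl fun n _ => by ring

/-- Large-`z` expansion (`z = xy/2`) of the cumulative noncentral beta distribution function,
with every remainder uniform in `p`, `q`, `y`, and its exactness for positive integers `q`. -/
theorem mainTheorem6 :
    (∀ (R ε δ : ℝ), 0 < R → 0 < ε → 0 < δ → ∀ N : ℕ,
      ∃ C Z : ℝ, 0 < C ∧ 0 < Z ∧
        ∀ p q x y : ℝ, 0 < p → p ≤ R → 0 < q → q ≤ R → ε ≤ p + q →
          0 < y → y ≤ 1 - δ → Z ≤ x * y / 2 →
          |noncentralBetaCDF p q x y -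
              largeZPrefactor p q x y * ∑ n ∈ Finset.range N, largeZTerm p q x y n| ≤
            C * largeZPrefactor p q x y / (x * y / 2) ^ N) ∧
    (∀ (p x y : ℝ) (k : ℕ), 0 < p → 1 ≤ k → 0 < x → 0 < y → y < 1 →
      (∀ n : ℕ, k ≤ n → largeZTerm p (k : ℝ) x y n = 0) ∧
      noncentralBetaCDF p (k : ℝ) x y =
        largeZPrefactor p (k : ℝ) x y *
          ∑ n ∈ Finset.range k, largeZTerm p (k : ℝ) x y n) := by
  refine ⟨fun R ε δ hR hε hδ N => ?_, fun p x y k hp hk hx hy0 hy1 => ⟨fun n hn => ?_, ?_⟩⟩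
  · obtain ⟨C, M, hC, hrem⟩ := exists_kummerRemainder_bound ⌈R⌉₊ N
    -- The maximum with `0` covers `δ > 1`, where no admissible `y` exists.
    set r : ℝ := max (1 - δ) 0 with hr
    have hr0 : 0 ≤ r := le_max_right _ _
    have hr1 : r < 1 := max_lt (by linarith) one_pos
    have hS := summable_pow_mul_add_pow M hr0 hr1 (1 + 2 * R)
    set S : ℝ := ∑' m : ℕ, r ^ m * (1 + 2 * R + m) ^ M with hSdef
    have hS0 : 0 ≤ S := tsum_nonneg fun m => by positivity
    -- `1/ε` comes from dividing by `p+q+m ≥ ε`, `S` from summing over `m`; the `+ 1` only makes the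
    -- constant positive.
    refine ⟨C / ε * S + 1, 1, by positivity, one_pos,
      fun p q x y hp hpR hq hqR hpq hy0 hyd hz => ?_⟩
    have hyr : y ≤ r := hyd.trans (le_max_left _ _)
    have hy1 : y < 1 := by linarith
    have hy : 0 < 1 - y := by linarith
    have hx : 0 < x := by
      by_contra! hx
      nlinarith
    have hz0 : 0 < x * y / 2 := by positivity
    have hg := Real.Gamma_pos_of_pos hq
    set E := Real.exp (-(1 - y) * x / 2) * (y ^ p * (1 - y) ^ q / Real.Gamma q) with hE
    have hE0 : 0 ≤ E := by
      have := Real.rpow_pos_of_pos hy q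
      positivity
    have hzp := Real.rpow_pos_of_pos hz0 (q - 1 - N)
    have hterm (m : ℕ) : ‖E * (y ^ m * kummerRemainder N q (p + q + m) (x * y / 2))‖ ≤
        E * (C / ε * (x * y / 2) ^ (q - 1 - N)) * (r ^ m * (1 + 2 * R + m) ^ M) := by
      have hm : (0 : ℝ) ≤ m := m.cast_nonneg
      have h1 := hrem q (p + q + m) (x * y / 2) hq (by linarith [Nat.le_ceil R])
        (by linarith) hz
      have h2 : |kummerRemainder N q (p + q + m) (x * y / 2)| ≤
          C / ε * (1 + 2 * R + m) ^ M * (x * y / 2) ^ (q - 1 - N) := by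
        have h3 : ε * |kummerRemainder N q (p + q + m) (x * y / 2)| ≤
            (p + q + m) * |kummerRemainder N q (p + q + m) (x * y / 2)| :=
          mul_le_mul_of_nonneg_right (by linarith) (abs_nonneg _)
        have h4 : C * (1 + (p + q + m)) ^ M * (x * y / 2) ^ (q - 1 - N) ≤
            C * (1 + 2 * R + m) ^ M * (x * y / 2) ^ (q - 1 - N) := by
          gcongr C * ?_ ^ M * _
          linarith
        rw [div_mul_eq_mul_div, div_mul_eq_mul_div, le_div_iff₀ hε]
        linarith
      rw [norm_mul, Real.norm_of_nonneg hE0, norm_mul, norm_pow, Real.norm_of_nonneg hy0.le,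
        Real.norm_eq_abs]
      calc E * (y ^ m * |kummerRemainder N q (p + q + m) (x * y / 2)|)
          ≤ E * (r ^ m * (C / ε * (1 + 2 * R + m) ^ M * (x * y / 2) ^ (q - 1 - N))) := by
            gcongr
        _ = _ := by ring
    have hsum := hasSum_noncentralBetaCDF_sub_expansion N hp hq hx hy0 hy1
    have hbound := tsum_of_norm_bounded (hS.hasSum.mul_left
      (E * (C / ε * (x * y / 2) ^ (q - 1 - N)))) hterm
    rw [hsum.tsum_eq, Real.norm_eq_abs] at hbound
    refine hbound.trans ?_
    have hP : E * (x * y / 2) ^ (q - 1 - N) =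
        largeZPrefactor p q x y / (x * y / 2) ^ N * (1 - y) := by
      rw [hE, largeZPrefactor, Real.rpow_sub_natCast hz0.ne', Real.rpow_sub_one hy.ne' q]
      field_simp
    have hP0 : 0 ≤ largeZPrefactor p q x y / (x * y / 2) ^ N := by
      rw [largeZPrefactor]
      have := Real.rpow_pos_of_pos hy (q - 1)
      positivity
    calc E * (C / ε * (x * y / 2) ^ (q - 1 - N)) * S
        = C / ε * S * (E * (x * y / 2) ^ (q - 1 - N)) := by ring
      _ = C / ε * S * (largeZPrefactor p q x y / (x * y / 2) ^ N * (1 - y)) := by rw [hP]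
      _ ≤ (C / ε * S + 1) * (largeZPrefactor p q x y / (x * y / 2) ^ N * 1) := by
          gcongr
          · linarith
          · linarith
      _ = _ := by ring
  · rw [largeZTerm, pochhammerSymbol_one_sub_natCast_eq_zero hk hn]
    ring
  · obtain ⟨l, rfl⟩ : ∃ l, k = l + 1 := ⟨k - 1, by omega⟩
    have hq : (0 : ℝ) < ((l + 1 : ℕ) : ℝ) := by positivity
    have h := hasSum_noncentralBetaCDF_sub_expansion (l + 1) hp hq hx hy0 hy1
    -- Every remainder in the series vanishes, since `p > 0` makes its parameter `a` exceed `q =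
    -- l+1`.
    have hzero (m : ℕ) :
        kummerRemainder (l + 1) ((l + 1 : ℕ) : ℝ) (p + (l + 1 : ℕ) + m) (x * y / 2) = 0 := by
      have hm : (0 : ℝ) ≤ m := m.cast_nonneg
      push_cast
      exact kummerRemainder_natCast l (by positivity) (by linarith)
    simp only [hzero, mul_zero] at h
    exact sub_eq_zero.mp (h.unique hasSum_zero)
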